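/- Let $S$ be a locally compact Hausdorff space, and let $\bar S$ be a compactification of $S$, i.e. a compact Hausdorff space containing $S$ as a dense subspace. For a topological space $X$, let $\mathfrak R(X)$ be the Boolean algebra of regular open subsets of $X$ (open sets $R$ with $R=\mathrm{int}(\mathrm{clos}\,R)$), with meet $Q\cap R$, join $Q\vee R=\mathrm{int}(\mathrm{clos}(Q\cup R))$ and complement $\neg R=\mathrm{int}(X\setminus R)$. A regular partition of $R\in\mathfrak R(X)$ is a finite family of disjoint elements of $\mathfrak R(X)$ with join $R$. A credence on $\mathfrak R(S)$ is a function $\mu:\mathfrak R(S)\to[0,1]$ with $\mu[S]=1$ and $\mu[R_1\vee\dots\vee R_N]=\sum_n\mu[R_n]$ for every finite family of disjoint $R_1,\dots,R_N\in\mathfrak R(S)$. For $R\in\mathfrak R(S)$ let $\mathcal G(R)=\{g|_R : g\in C_b(S,\mathbb R)\}$, with the uniform norm. An integrator is a family $\{\mathbb I_R\}_{R\in\mathfrak R(S)}$ of bounded linear functionals $\mathbb I_R:\mathcal G(R)\to\mathbb R$ such that $\mathbb I_R[f]\le\mathbb I_R[g]$ whenever $f\le g$ on $R$, and $\mathbb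 I_R[g]=\sum_n\mathbb I_{R_n}[g|_{R_n}]$ for every regular partition $\{R_1,\dots,R_N\}$ of $R$; it is compatible with $\mu$ if $\|\mathbb I_R\|=\mu[R]$ for all $R$. For $g\in C_b(S,\mathbb R)$ write $\mathbb I_R[g]$ for $\mathbb I_R[g|_R]$. A Borel measure $\nu$ on $\bar S$ is normal if, for every Borel set $B$, $\nu(B)$ is the supremum of $\nu(C)$ over closed $C\subseteq B$ and the infimum of $\nu(O)$ over open $O\supseteq B$. A liminal density structure subordinate to $\nu$ is a family $\{\phi_R\}_{R\in\mathfrak R(\bar S)}$ of classes $\phi_R\in L^1(\partial R,\nu;[0,1])$ such that, for every regular partition $\{R_1,\dots,R_N\}$ of $\bar S$, $\phi_{R_1}+\dots+\phi_{R_N}=1$ $\nu$-almost everywhere on $\partial R_1\cup\dots\cup\partial R_N$, where each $\phi_{R_n}$ is extended by $0$ off $\partial R_n$. Theorem. Let $\mu$ be a credence on $\mathfrak R(S)$. There is a unique integrator $\{\mathbb I_R\}_{R\in\mathfrak R(S)}$ compatible with $\mu$, and for every $R\in\mathfrak R(S)$ there is a unique $\bar R\in\mathfrak R(\bar S)$ with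 $\bar R\cap S=R$. There are a unique normal Borel measure $\bar\nu$ on $\bar S$ and a unique liminal density structure $\{\bar\phi_R\}_{R\in\mathfrak R(\bar S)}$ subordinate to $\bar\nu$ such that, for every $R\in\mathfrak R(S)$, $$\mu[R]=\bar\nu(\bar R)+\int_{\partial\bar R}\bar\phi_{\bar R}\,d\bar\nu ,$$ and $\bar\nu$ is a probability measure. Furthermore, for every $R\in\mathfrak R(S)$ and every $f\in C(S,\mathbb R)$ that has a continuous extension $\bar f\in C(\bar S,\mathbb R)$, $$\mathbb I_R[f]=\int_{\bar R}\bar f\,d\bar\nu+\int_{\partial\bar R}\bar f\,\bar\phi_{\bar R}\,d\bar\nu .$$ -/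

import Mathlib

open MeasureTheory TopologicalSpace
open scoped BoundedContinuousFunction

/-- The Boolean algebra of regular open subsets of a topological space: the Heyting-regular
elements of the frame of open sets.  `RegOpen.isRegular_iff`, `RegOpen.set_compl`, `RegOpen.set_inf`,
`RegOpen.set_finset_sup` and `RegOpen.disjoint_iff` below check that regularity means
`U = int (clos U)`, and that the operations are the usual ones on regular open sets. -/
abbrev RegOpen (S : Type*) [TopologicalSpace S] : Type _ := Heyting.Regular (Opens S)

/-- The underlying subset of a regular open set. -/
def RegOpen.set {S : Type*} [TopologicalSpace S] (R : RegOpen S) : Set S :=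
  ((R : Opens S) : Set S)

theorem RegOpen.coe_compl_compl_eq {S : Type*} [TopologicalSpace S] (U : Opens S) :
    ((Uᶜᶜ : Opens S) : Set S) = interior (closure (U : Set S)) := by
  rw [Opens.coe_compl_eq_interior_compl, Opens.coe_compl_eq_interior_compl, interior_compl]
  simp

theorem RegOpen.isRegular_iff {S : Type*} [TopologicalSpace S] (U : Opens S) :
    Heyting.IsRegular U ↔ (U : Set S) = interior (closure (U : Set S)) := by
  rw [← RegOpen.coe_compl_compl_eq, SetLike.coe_set_eq]
  exact eq_comm

theorem RegOpen.ext_set {S : Type*} [TopologicalSpace S] {Q R : RegOpen S}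
    (h : Q.set = R.set) : Q = R :=
  Heyting.Regular.coe_injective (SetLike.coe_injective h)

theorem RegOpen.isOpen_set {S : Type*} [TopologicalSpace S] (R : RegOpen S) :
    IsOpen R.set := (R : Opens S).isOpen

theorem RegOpen.set_top {S : Type*} [TopologicalSpace S] : (⊤ : RegOpen S).set = Set.univ := rfl

theorem RegOpen.set_bot {S : Type*} [TopologicalSpace S] : (⊥ : RegOpen S).set = ∅ := rfl

theorem RegOpen.set_inf {S : Type*} [TopologicalSpace S] (Q R : RegOpen S) :
    (Q ⊓ R).set = Q.set ∩ R.set := rfl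

theorem RegOpen.set_compl {S : Type*} [TopologicalSpace S] (R : RegOpen S) :
    (Rᶜ).set = interior (R.set)ᶜ := Opens.coe_compl_eq_interior_compl

theorem RegOpen.set_sup {S : Type*} [TopologicalSpace S] (Q R : RegOpen S) :
    (Q ⊔ R).set = interior (closure (Q.set ∪ R.set)) :=
  RegOpen.coe_compl_compl_eq ((Q : Opens S) ⊔ (R : Opens S))

theorem RegOpen.disjoint_iff {S : Type*} [TopologicalSpace S] (Q R : RegOpen S) :
    Disjoint Q R ↔ Disjoint Q.set R.set := by
  rw [_root_.disjoint_iff, Set.disjoint_iff_inter_eq_empty, ← RegOpen.set_inf,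
    ← RegOpen.set_bot]
  exact ⟨fun h => congrArg RegOpen.set h, fun h => RegOpen.ext_set h⟩

theorem RegOpen.set_finset_sup {S : Type*} [TopologicalSpace S] {N : ℕ}
    (B : Fin N → RegOpen S) :
    (Finset.univ.sup B).set = interior (closure (⋃ n, (B n).set)) := by
  have h : Finset.univ.sup B = Heyting.Regular.toRegular (⨆ n, (B n : Opens S)) := by
    have h2 := (Heyting.Regular.gi (α := Opens S)).gc
    apply le_antisymm
    · refine Finset.sup_le fun n _ => ?_
      have h3 : (B n : Opens S) ≤ ⨆ n, (B n : Opens S) := le_iSup (fun n => (B n : Opens S)) n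
      exact Heyting.Regular.coe_le_coe.1 (h3.trans (h2.le_u_l _))
    · refine h2.l_le (iSup_le fun n => ?_)
      exact Heyting.Regular.coe_le_coe.2 (Finset.le_sup (Finset.mem_univ n))
  rw [h]
  refine (RegOpen.coe_compl_compl_eq (⨆ n, (B n : Opens S))).trans ?_
  rw [Opens.coe_iSup]
  rfl

/-- `B 0, …, B (N-1)` is a regular open partition of `R`: the members are disjoint and their
join (in the algebra of regular open sets) is `R`. -/
def IsRegPartition {S : Type*} [TopologicalSpace S] {N : ℕ} (R : RegOpen S)
    (B : Fin N → RegOpen S) : Prop :=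
  Pairwise (fun i j => Disjoint (B i) (B j)) ∧ Finset.univ.sup B = R

/-- A credence on the Boolean algebra of all regular open subsets of `S`. -/
structure Credence (S : Type*) [TopologicalSpace S] where
  toFun : RegOpen S → ℝ
  mem_Icc : ∀ R, toFun R ∈ Set.Icc (0 : ℝ) 1
  top_eq : toFun ⊤ = 1
  additive : ∀ (N : ℕ) (B : Fin N → RegOpen S), Pairwise (fun i j => Disjoint (B i) (B j)) →
    toFun (Finset.univ.sup B) = ∑ n, toFun (B n)

/-- Restriction of bounded continuous functions to a subset. -/
def restrictCb {S : Type*} [TopologicalSpace S] (B : Set S) : (S →ᵇ ℝ) →ₗ[ℝ] (B →ᵇ ℝ) where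
  toFun g := g.compContinuous ⟨Subtype.val, continuous_subtype_val⟩
  map_add' _ _ := rfl
  map_smul' _ _ := rfl

/-- The space of restrictions to `B` of bounded continuous functions on `S`, as a linear
subspace of the bounded continuous functions on `B`, with the uniform norm. -/
abbrev RestrSpace {S : Type*} [TopologicalSpace S] (B : Set S) : Submodule ℝ (B →ᵇ ℝ) :=
  LinearMap.range (restrictCb B)

/-- The restriction of `g` to `B`, as an element of `RestrSpace B`. -/
def restrTo {S : Type*} [TopologicalSpace S] (B : Set S) (g : S →ᵇ ℝ) :
    RestrSpace B :=
  ⟨restrictCb B g, g, rfl⟩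

/-- An integrator on the algebra of all regular open subsets of `S` (for this full algebra every
continuous function is comeasurable). -/
structure Integrator (S : Type*) [TopologicalSpace S] where
  functional : (R : RegOpen S) → RestrSpace R.set →ₗ[ℝ] ℝ
  bounded : ∀ R : RegOpen S, ∃ C : ℝ, ∀ g, |functional R g| ≤ C * ‖g‖
  mono : ∀ (R : RegOpen S) (f g : RestrSpace R.set),
    (∀ b, (f : R.set →ᵇ ℝ) b ≤ (g : R.set →ᵇ ℝ) b) → functional R f ≤ functional R g
  partition : ∀ (R : RegOpen S) (N : ℕ) (B : Fin N → RegOpen S), IsRegPartition R B →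
    ∀ g : S →ᵇ ℝ, functional R (restrTo R.set g) = ∑ n, functional (B n) (restrTo (B n).set g)

/-- `I` is compatible with `μ`: for every regular open `R`, the operator norm of the functional
`I_R` (the least constant bounding it, for the uniform norm on `R`) is `μ[R]`. -/
def Integrator.IsCompatible {S : Type*} [TopologicalSpace S] (I : Integrator S)
    (μ : Credence S) : Prop :=
  ∀ R : RegOpen S,
    IsLeast {C : ℝ | 0 ≤ C ∧ ∀ g : RestrSpace R.set, |I.functional R g| ≤ C * ‖g‖} (μ.toFun R)

/-- The integral of (the restriction to `R` of) `g` over `R`. -/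
def Integrator.int {S : Type*} [TopologicalSpace S] (I : Integrator S)
    (R : RegOpen S) (g : S →ᵇ ℝ) : ℝ :=
  I.functional R (restrTo R.set g)

/-- Normality of a Borel measure: every measurable set is approximated in measure from within by
closed sets and from outside by open sets. -/
def IsNormalMeasure {X : Type*} [TopologicalSpace X] [MeasurableSpace X] (ν : Measure X) : Prop :=
  ν.InnerRegularWRT IsClosed MeasurableSet ∧ ν.OuterRegular

/-- A liminal density structure subordinate to `ν`.  Only the `ν`-a.e. class of `density R` on the
boundary of `R` is meaningful; in the sum each density is extended by zero off that boundary. -/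
structure LiminalDensity {X : Type*} [TopologicalSpace X] [MeasurableSpace X]
    (ν : Measure X) where
  density : RegOpen X → X → ℝ
  integrable : ∀ R : RegOpen X, IntegrableOn (density R) (frontier R.set) ν
  mem_Icc : ∀ R : RegOpen X,
    ∀ᵐ x ∂(ν.restrict (frontier R.set)), density R x ∈ Set.Icc (0 : ℝ) 1
  partition : ∀ (N : ℕ) (B : Fin N → RegOpen X), IsRegPartition ⊤ B →
    ∀ᵐ x ∂(ν.restrict (⋃ n, frontier (B n).set)),
      ∑ n, (frontier (B n).set).indicator (density (B n)) x = 1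

/-- `Rbar` is an extension of `R` along `ι : S → Sbar`: the trace of `Rbar` on `S` is `R`. -/
def IsRegExtension {S Sbar : Type*} [TopologicalSpace S] [TopologicalSpace Sbar] (ι : S → Sbar)
    (R : RegOpen S) (Rbar : RegOpen Sbar) : Prop :=
  ι ⁻¹' Rbar.set = R.set

/-- `μ[R] = ν(R̄) + ∫_{∂R̄} φ_{R̄} dν` for every regular open `R` and its extension `R̄`. -/
def Represents {S Sbar : Type*} [TopologicalSpace S] [TopologicalSpace Sbar]
    [MeasurableSpace Sbar] (ι : S → Sbar) (ν : Measure Sbar) (φ : LiminalDensity ν)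
    (μ : Credence S) : Prop :=
  ∀ (R : RegOpen S) (Rbar : RegOpen Sbar), IsRegExtension ι R Rbar →
    μ.toFun R = ν.real Rbar.set + ∫ x in frontier Rbar.set, φ.density Rbar x ∂ν

/-! Riemann sums of a bounded continuous function over finite regular partitions, passed to the
limit along an ultrafilter of ever finer partitions, give an integrator compatible with `μ`.  It is
the only one: on the pieces of a fine partition the function is nearly constant, so an integrator
is determined by its values on the constant `1`.

Taking traces identifies the regular open sets of a compactification with those of the dense
subspace, so credences and integrators can be transported to the compactification.  There the
Riesz theorem represents the integral over `R` by a measure `m R`, and `m R ≤ m ⊤ = ν`.  The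
Radon–Nikodym density of `m R` with respect to `ν` is `1` on `R` and `0` off the closure of `R`, so
the only further information it carries is its restriction to the boundary, the liminal density.
Conversely, a measure and its liminal densities determine an integrator, and are recovered from it
because continuous functions are dense in `L²`. -/

open Filter Topology

/-- Finite additivity of a function on a lattice: its value on a disjoint join is the sum of its
values.  Credences, and integrals as functions of the domain of integration, are the examples of
interest. -/
def IsFinitelyAdditive {α M : Type*} [Lattice α] [OrderBot α] [Add M] (Φ : α → M) : Prop :=
  ∀ a b, Disjoint a b → Φ (a ⊔ b) = Φ a + Φ b

namespace IsFinitelyAdditive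

variable {α M : Type*} [DistribLattice α] [OrderBot α] [AddCancelCommMonoid M] {Φ : α → M}

theorem map_bot (h : IsFinitelyAdditive Φ) : Φ ⊥ = 0 := by
  simpa using h ⊥ ⊥ disjoint_bot_left

theorem map_finset_sup (h : IsFinitelyAdditive Φ) {κ : Type*} (s : Finset κ) (B : κ → α)
    (hB : (s : Set κ).PairwiseDisjoint B) : Φ (s.sup B) = ∑ i ∈ s, Φ (B i) := by
  classical
  induction s using Finset.induction_on with
  | empty => simpa using h.map_bot
  | insert i s hi ih =>
    have hd : Disjoint (B i) (s.sup B) := Finset.disjoint_sup_right.2 fun j hj =>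
      hB (by simp) (by simp [hj]) (ne_of_mem_of_not_mem hj hi).symm
    rw [Finset.sup_insert, Finset.sum_insert hi, h _ _ hd, ih (hB.subset (by simp))]

theorem sum_inf_parts (h : IsFinitelyAdditive Φ) {a : α} (P : Finpartition a) (b : α) :
    ∑ q ∈ P.parts, Φ (b ⊓ q) = Φ (b ⊓ a) := by
  rw [← h.map_finset_sup P.parts (b ⊓ ·) (P.disjoint.mono fun _ => inf_le_right)]
  exact congrArg Φ ((Finset.sup_inf_distrib_left P.parts id b).symm.trans
    (congrArg (b ⊓ ·) P.sup_parts))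

end IsFinitelyAdditive

theorem eventually_forall_parts_le_or_le_compl {α : Type*} [BooleanAlgebra α] (a : α) :
    ∀ᶠ P : Finpartition (⊤ : α) in atBot, ∀ q ∈ P.parts, q ≤ a ∨ q ≤ aᶜ := by
  classical
  have hs : ({a, aᶜ} : Finset α).SupIndep id := by
    refine Finset.supIndep_iff_pairwiseDisjoint.2 ?_
    simpa [Set.pairwiseDisjoint_insert] using fun _ => disjoint_compl_right
  filter_upwards [eventually_le_atBot (Finpartition.ofErase {a, aᶜ} hs (by simp))] with P hP q hq
  obtain ⟨c, hc, hqc⟩ := hP hq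
  simp only [Finpartition.ofErase, Finset.mem_erase, Finset.mem_insert,
    Finset.mem_singleton] at hc
  rcases hc.2 with rfl | rfl
  exacts [Or.inl hqc, Or.inr hqc]

theorem eventually_forall_parts_exists_le {α κ : Type*} [BooleanAlgebra α] {s : Finset κ}
    {C : κ → α} (hs : s.sup C = ⊤) :
    ∀ᶠ P : Finpartition (⊤ : α) in atBot, ∀ q ∈ P.parts, ∃ c ∈ s, q ≤ C c := by
  filter_upwards [(eventually_all_finset s).2 fun c _ =>
    eventually_forall_parts_le_or_le_compl (C c)] with P hP q hq
  by_contra! h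
  have hdisj : Disjoint q (s.sup C) := Finset.disjoint_sup_right.2 fun c hc =>
    le_compl_iff_disjoint_right.1 ((hP c hc q hq).resolve_left (h c hc))
  rw [hs, disjoint_top] at hdisj
  exact P.ne_bot hq hdisj

namespace RegOpen

variable {S : Type*} [TopologicalSpace S]

theorem set_subset_iff {Q R : RegOpen S} : Q.set ⊆ R.set ↔ Q ≤ R := Iff.rfl

theorem interior_closure_set (R : RegOpen S) : interior (closure R.set) = R.set :=
  ((isRegular_iff (R : Opens S)).1 R.2).symm

theorem closure_set_compl (R : RegOpen S) : closure (Rᶜ).set = (R.set)ᶜ := by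
  rw [set_compl, interior_compl, closure_compl, interior_closure_set]

theorem mem_of_mem_closure_of_notMem_frontier {R : RegOpen S} {x : S} (hx : x ∈ closure R.set)
    (hx' : x ∉ frontier R.set) : x ∈ R.set := by
  by_contra h
  exact hx' (R.isOpen_set.frontier_eq ▸ ⟨hx, h⟩)

theorem notMem_of_mem_frontier {R : RegOpen S} {x : S} (hx : x ∈ frontier R.set) : x ∉ R.set :=
  (R.isOpen_set.frontier_eq ▸ hx).2

theorem disjoint_closure {Q R : RegOpen S} (h : Disjoint Q R) :
    Disjoint Q.set (closure R.set) :=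
  ((disjoint_iff Q R).1 h).closure_right Q.isOpen_set

/-- The regular open hull `int (clos U)` of an open set `U`, i.e. the least regular open set
containing it. -/
def hull (U : Opens S) : RegOpen S := Heyting.Regular.toRegular U

theorem set_hull (U : Opens S) : (hull U).set = interior (closure (U : Set S)) :=
  coe_compl_compl_eq U

theorem subset_hull (U : Opens S) : (U : Set S) ⊆ (hull U).set := by
  rw [set_hull]
  exact U.isOpen.subset_interior_closure

theorem exists_mem_of_ne_bot {R : RegOpen S} (hR : R ≠ ⊥) : ∃ x, x ∈ R.set :=
  Set.nonempty_iff_ne_empty.2 fun h => hR (ext_set h)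

theorem isRegPartition_pair {a b : RegOpen S} (h : Disjoint a b) :
    IsRegPartition (a ⊔ b) ![a, b] := by
  refine ⟨fun i j hij => ?_, by simp [Fin.univ_succ]⟩
  fin_cases i <;> fin_cases j <;> simp_all [disjoint_comm]

theorem isRegPartition_top_pair (a : RegOpen S) : IsRegPartition ⊤ ![a, aᶜ] := by
  simpa using isRegPartition_pair (disjoint_compl_right (a := a))

theorem isRegPartition_top_triple {a b : RegOpen S} (h : Disjoint a b) :
    IsRegPartition ⊤ ![a, b, (a ⊔ b)ᶜ] := by
  have ha : Disjoint a (a ⊔ b)ᶜ := disjoint_compl_right.mono_left le_sup_left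
  have hb : Disjoint b (a ⊔ b)ᶜ := disjoint_compl_right.mono_left le_sup_right
  refine ⟨fun i j hij => ?_, ?_⟩
  · fin_cases i <;> fin_cases j <;> first | exact absurd rfl hij | skip
    exacts [h, ha, h.symm, hb, ha.symm, hb.symm]
  · have hsup : Finset.univ.sup ![a, b, (a ⊔ b)ᶜ] = (a ⊔ b) ⊔ (a ⊔ b)ᶜ := by
      simp only [Fin.univ_succ]
      simp [sup_assoc]
    rw [hsup, sup_compl_eq_top]

theorem eventually_forall_parts_abs_sub_le (g : S →ᵇ ℝ) {ε : ℝ} (hε : 0 < ε) :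
    ∀ᶠ P : Finpartition (⊤ : RegOpen S) in atBot,
      ∀ q ∈ P.parts, ∃ c, ∀ x ∈ q.set, |g x - c| ≤ ε := by
  obtain ⟨t, ht, hcov⟩ := Metric.totallyBounded_iff.1
    (g.isBounded_range.isCompact_closure.totallyBounded.subset subset_closure) ε hε
  lift t to Finset ℝ using ht
  let C : ℝ → RegOpen S := fun c =>
    hull ⟨g ⁻¹' Metric.ball c ε, Metric.isOpen_ball.preimage g.continuous⟩
  have hC : ∀ c, ∀ x ∈ (C c).set, |g x - c| ≤ ε := fun c x hx => by
    rw [set_hull] at hx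
    have hx' : x ∈ g ⁻¹' Metric.closedBall c ε :=
      closure_minimal (Set.preimage_mono Metric.ball_subset_closedBall)
        (Metric.isClosed_closedBall.preimage g.continuous) (interior_subset hx)
    simpa [Real.dist_eq] using hx'
  have htop : t.sup C = ⊤ := top_le_iff.1 fun x _ => by
    obtain ⟨c, hc, hx⟩ := Set.mem_iUnion₂.1 (hcov ⟨x, rfl⟩)
    exact set_subset_iff.2 (Finset.le_sup (f := C) hc) (subset_hull _ hx)
  filter_upwards [eventually_forall_parts_exists_le htop] with P hP q hq
  obtain ⟨c, -, hqc⟩ := hP q hq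
  exact ⟨c, fun x hx => hC c x (set_subset_iff.2 hqc hx)⟩

end RegOpen

namespace IsRegPartition

variable {S : Type*} [TopologicalSpace S] {N : ℕ} {R : RegOpen S} {B : Fin N → RegOpen S}

theorem map_eq_sum {M : Type*} [AddCancelCommMonoid M] (hB : IsRegPartition R B)
    {Φ : RegOpen S → M} (hΦ : IsFinitelyAdditive Φ) : Φ R = ∑ n, Φ (B n) := by
  rw [← hB.2]
  exact hΦ.map_finset_sup _ B fun i _ j _ hij => hB.1 hij

theorem notMem_of_mem_frontier (hB : IsRegPartition R B) {x : S} {n : Fin N}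
    (hx : x ∈ frontier (B n).set) (i : Fin N) : x ∉ (B i).set := fun hi => by
  rcases eq_or_ne i n with rfl | hin
  · exact RegOpen.notMem_of_mem_frontier hx hi
  · exact Set.disjoint_left.1 (RegOpen.disjoint_closure (hB.1 hin)) hi hx.1

theorem exists_mem_of_forall_notMem_frontier (hB : IsRegPartition ⊤ B) {x : S}
    (hx : ∀ n, x ∉ frontier (B n).set) : ∃ n, x ∈ (B n).set := by
  have hcl : x ∈ closure (⋃ n, (B n).set) := by
    refine interior_subset ?_
    rw [← RegOpen.set_finset_sup, hB.2]
    trivial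
  rw [closure_iUnion_of_finite] at hcl
  obtain ⟨n, hn⟩ := Set.mem_iUnion.1 hcl
  exact ⟨n, RegOpen.mem_of_mem_closure_of_notMem_frontier hn (hx n)⟩

end IsRegPartition

/-- Monotonicity of a linear functional with respect to the pointwise order on `B`.  Such a
functional depends only on the restrictions to `B`. -/
def IsMonotoneOver {S : Type*} [TopologicalSpace S] (B : Set S) (L : (S →ᵇ ℝ) →ₗ[ℝ] ℝ) : Prop :=
  ∀ f g : S →ᵇ ℝ, (∀ x ∈ B, f x ≤ g x) → L f ≤ L g

namespace IsMonotoneOver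

variable {S : Type*} [TopologicalSpace S] {B : Set S} {L : (S →ᵇ ℝ) →ₗ[ℝ] ℝ}

theorem nonneg (hL : IsMonotoneOver B L) {f : S →ᵇ ℝ} (hf : ∀ x ∈ B, 0 ≤ f x) : 0 ≤ L f := by
  simpa using hL 0 f hf

theorem eq_zero (hL : IsMonotoneOver B L) {f : S →ᵇ ℝ} (hf : ∀ x ∈ B, f x = 0) : L f = 0 :=
  le_antisymm (by simpa using hL f 0 fun x hx => (hf x hx).le) (hL.nonneg fun x hx => (hf x hx).ge)

theorem abs_sub_mul_le (hL : IsMonotoneOver B L) {g : S →ᵇ ℝ} {c ε : ℝ}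
    (hg : ∀ x ∈ B, |g x - c| ≤ ε) : |L g - c * L 1| ≤ ε * L 1 := by
  have hle : L g ≤ L ((c + ε) • 1) := hL _ _ fun x hx => by
    simpa using by linarith [(abs_le.1 (hg x hx)).2]
  have hge : L ((c - ε) • 1) ≤ L g := hL _ _ fun x hx => by
    simpa using by linarith [(abs_le.1 (hg x hx)).1]
  rw [map_smul, smul_eq_mul] at hle hge
  exact abs_le.2 ⟨by linarith, by linarith⟩

theorem abs_le (hL : IsMonotoneOver B L) (g : S →ᵇ ℝ) : |L g| ≤ L 1 * ‖restrTo B g‖ := by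
  have hg : ∀ x ∈ B, |g x - 0| ≤ ‖restrTo B g‖ := fun x hx => by
    rw [sub_zero]
    exact (restrictCb B g).norm_coe_le_norm ⟨x, hx⟩
  simpa [mul_comm] using hL.abs_sub_mul_le hg

/-- The functional induced on the space of restrictions to `B`. -/
noncomputable def descend (hL : IsMonotoneOver B L) : RestrSpace B →ₗ[ℝ] ℝ :=
  (LinearMap.ker (restrictCb B)).liftQ L (fun _ hf =>
    hL.eq_zero fun x hx => DFunLike.congr_fun (LinearMap.mem_ker.1 hf) ⟨x, hx⟩) ∘ₗ
      (restrictCb B).quotKerEquivRange.symm.toLinearMap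

theorem descend_restrTo (hL : IsMonotoneOver B L) (g : S →ᵇ ℝ) :
    hL.descend (restrTo B g) = L g := by
  have hg : (restrictCb B).quotKerEquivRange.symm (restrTo B g) = Submodule.Quotient.mk g :=
    (restrictCb B).quotKerEquivRange_symm_apply_image g ⟨g, rfl⟩
  rw [descend, LinearMap.comp_apply, LinearEquiv.coe_coe, hg]
  rfl

end IsMonotoneOver

namespace Integrator

variable {S : Type*} [TopologicalSpace S]

theorem restrTo_surjective (B : Set S) : Function.Surjective (restrTo B) := by
  rintro ⟨_, g, rfl⟩
  exact ⟨g, rfl⟩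

/-- The integral over `R` as a linear functional on the bounded continuous functions on `S`. -/
def intLM (I : Integrator S) (R : RegOpen S) : (S →ᵇ ℝ) →ₗ[ℝ] ℝ :=
  I.functional R ∘ₗ (restrictCb R.set).rangeRestrict

theorem intLM_apply (I : Integrator S) (R : RegOpen S) (g : S →ᵇ ℝ) : I.intLM R g = I.int R g :=
  rfl

theorem isMonotoneOver_intLM (I : Integrator S) (R : RegOpen S) :
    IsMonotoneOver R.set (I.intLM R) :=
  fun _ _ h => I.mono R _ _ fun b => h b b.2

theorem isFinitelyAdditive_intLM (I : Integrator S) : IsFinitelyAdditive I.intLM :=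
  fun _ _ h => LinearMap.ext fun g =>
    (I.partition _ 2 _ (RegOpen.isRegPartition_pair h) g).trans (Fin.sum_univ_two _)

theorem ext_int {I I' : Integrator S} (h : ∀ R g, I.int R g = I'.int R g) : I = I' := by
  have hfun : I.functional = I'.functional := funext fun R => LinearMap.ext fun f => by
    obtain ⟨g, rfl⟩ := restrTo_surjective _ f
    exact h R g
  cases I
  cases I'
  congr

/-- The integrator given by a finitely additive family of functionals on the bounded continuous
functions, each monotone over its domain of integration. -/
noncomputable def ofLinearMaps (J : RegOpen S → (S →ᵇ ℝ) →ₗ[ℝ] ℝ) (hadd : IsFinitelyAdditive J)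
    (hmono : ∀ R, IsMonotoneOver R.set (J R)) : Integrator S where
  functional R := (hmono R).descend
  bounded R := ⟨J R 1, fun f => by
    obtain ⟨g, rfl⟩ := restrTo_surjective _ f
    simpa only [IsMonotoneOver.descend_restrTo] using (hmono R).abs_le g⟩
  mono R f g h := by
    obtain ⟨f, rfl⟩ := restrTo_surjective _ f
    obtain ⟨g, rfl⟩ := restrTo_surjective _ g
    simpa only [IsMonotoneOver.descend_restrTo] using hmono R f g fun x hx => h ⟨x, hx⟩
  partition R N B hB g := by
    simpa only [IsMonotoneOver.descend_restrTo, LinearMap.sum_apply] using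
      DFunLike.congr_fun (hB.map_eq_sum hadd) g

theorem int_ofLinearMaps {J : RegOpen S → (S →ᵇ ℝ) →ₗ[ℝ] ℝ} (hadd : IsFinitelyAdditive J)
    (hmono : ∀ R, IsMonotoneOver R.set (J R)) (R : RegOpen S) (g : S →ᵇ ℝ) :
    (ofLinearMaps J hadd hmono).int R g = J R g :=
  (hmono R).descend_restrTo g

theorem isCompatible_iff {I : Integrator S} {μ : Credence S} :
    I.IsCompatible μ ↔ ∀ R, I.int R 1 = μ.toFun R := by
  refine forall_congr' fun R => ?_
  have hmono := I.isMonotoneOver_intLM R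
  have hleast : IsLeast {C : ℝ | 0 ≤ C ∧ ∀ g : RestrSpace R.set, |I.functional R g| ≤ C * ‖g‖}
      (I.int R 1) := by
    refine ⟨⟨hmono.nonneg fun _ _ => zero_le_one, fun f => ?_⟩, fun C hC => ?_⟩
    · obtain ⟨g, rfl⟩ := restrTo_surjective _ f
      exact hmono.abs_le g
    · have hnorm : ‖restrTo R.set (1 : S →ᵇ ℝ)‖ ≤ 1 :=
        (BoundedContinuousFunction.norm_le zero_le_one).2 fun b => norm_one.le
      calc I.int R 1 ≤ |I.int R 1| := le_abs_self _
        _ ≤ C * ‖restrTo R.set (1 : S →ᵇ ℝ)‖ := hC.2 _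
        _ ≤ C := mul_le_of_le_one_right hC.1 hnorm
  exact ⟨fun h => hleast.unique h, fun h => h ▸ hleast⟩

theorem abs_int_sub_int_le {I I' : Integrator S} (h : ∀ R, I.int R 1 = I'.int R 1) (R : RegOpen S)
    (g : S →ᵇ ℝ) {ε : ℝ} (hε : 0 < ε) : |I.int R g - I'.int R g| ≤ 2 * ε * I.int R 1 := by
  classical
  obtain ⟨P, hP⟩ := (RegOpen.eventually_forall_parts_abs_sub_le g hε).exists
  have hsum : ∀ (I : Integrator S) f, I.int R f = ∑ q ∈ P.parts, I.int (R ⊓ q) f := fun I f => by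
    have hf := I.isFinitelyAdditive_intLM.sum_inf_parts P R
    rw [inf_top_eq] at hf
    exact (DFunLike.congr_fun hf f).symm.trans (LinearMap.sum_apply _ _ f)
  rw [hsum I g, hsum I' g, hsum I 1, ← Finset.sum_sub_distrib, Finset.mul_sum]
  refine (Finset.abs_sum_le_sum_abs _ _).trans (Finset.sum_le_sum fun q hq => ?_)
  obtain ⟨c, hc⟩ := hP q hq
  have hI := (I.isMonotoneOver_intLM (R ⊓ q)).abs_sub_mul_le fun x hx => hc x hx.2
  have hI' := (I'.isMonotoneOver_intLM (R ⊓ q)).abs_sub_mul_le fun x hx => hc x hx.2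
  simp only [intLM_apply, ← h] at hI hI'
  rw [abs_le] at *
  constructor <;> linarith

theorem eq_of_int_one_eq {I I' : Integrator S} (h : ∀ R, I.int R 1 = I'.int R 1) : I = I' := by
  refine ext_int fun R g => sub_eq_zero.1 (abs_nonpos_iff.1 ?_)
  have hlim : Tendsto (fun ε : ℝ => 2 * ε * I.int R 1) (𝓝[>] 0) (𝓝 0) :=
    Tendsto.mono_left (Continuous.tendsto' (by fun_prop) _ _ (by simp)) nhdsWithin_le_nhds
  exact ge_of_tendsto hlim (eventually_mem_nhdsWithin.mono fun ε hε => abs_int_sub_int_le h R g hε)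

theorem IsCompatible.unique {I I' : Integrator S} {μ : Credence S} (h : I.IsCompatible μ)
    (h' : I'.IsCompatible μ) : I = I' :=
  eq_of_int_one_eq fun R => (isCompatible_iff.1 h R).trans (isCompatible_iff.1 h' R).symm

end Integrator

theorem exists_linearMap_tendsto {κ E : Type*} [AddCommGroup E] [Module ℝ E] (U : Ultrafilter κ)
    (F : κ → E →ₗ[ℝ] ℝ) (C : E → ℝ) (hF : ∀ i x, |F i x| ≤ C x) :
    ∃ J : E →ₗ[ℝ] ℝ, ∀ x, Tendsto (fun i => F i x) U (𝓝 (J x)) := by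
  have hlim : ∀ x, ∃ L, Tendsto (fun i => F i x) U (𝓝 L) := fun x => by
    obtain ⟨L, -, hL⟩ := (isCompact_closedBall (0 : ℝ) (C x)).ultrafilter_le_nhds
      (U.map fun i => F i x) (le_principal_iff.2 (Ultrafilter.mem_map.2
        (Eventually.of_forall fun i => by simpa using hF i x)))
    exact ⟨L, hL⟩
  choose L hL using hlim
  exact ⟨linearMapOfTendsto L F (tendsto_pi_nhds.2 hL), hL⟩

namespace Credence

variable {S : Type*} [TopologicalSpace S] (μ : Credence S)

theorem nonneg (R : RegOpen S) : 0 ≤ μ.toFun R := (μ.mem_Icc R).1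

theorem isFinitelyAdditive : IsFinitelyAdditive μ.toFun := fun a b h => by
  have hB := RegOpen.isRegPartition_pair h
  rw [← hB.2, μ.additive 2 _ hB.1]
  simp [Fin.sum_univ_two]

include μ in
theorem nonempty : Nonempty S := by
  by_contra h
  rw [not_nonempty_iff] at h
  have htop : (⊤ : RegOpen S) = ⊥ := RegOpen.ext_set (Set.eq_empty_of_isEmpty _)
  have hone := μ.top_eq
  rw [htop, μ.isFinitelyAdditive.map_bot] at hone
  exact zero_ne_one hone

theorem sum_inf_parts (R : RegOpen S) (P : Finpartition (⊤ : RegOpen S)) :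
    ∑ q ∈ P.parts, μ.toFun (R ⊓ q) = μ.toFun R :=
  (μ.isFinitelyAdditive.sum_inf_parts P R).trans (congrArg μ.toFun (inf_top_eq R))

/-- The Riemann sum over `R` along a finite partition `P` of the whole space: the value at the tag
`t q` of each part `q` is weighted by the credence of `R ⊓ q`. -/
noncomputable def riemannSum (t : RegOpen S → S) (P : Finpartition (⊤ : RegOpen S))
    (R : RegOpen S) : (S →ᵇ ℝ) →ₗ[ℝ] ℝ where
  toFun g := ∑ q ∈ P.parts, μ.toFun (R ⊓ q) * g (t q)
  map_add' f g := by simp [mul_add, Finset.sum_add_distrib]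
  map_smul' c g := by simp [Finset.mul_sum, mul_left_comm]

theorem riemannSum_apply (t : RegOpen S → S) (P : Finpartition (⊤ : RegOpen S))
    (R : RegOpen S) (g : S →ᵇ ℝ) :
    μ.riemannSum t P R g = ∑ q ∈ P.parts, μ.toFun (R ⊓ q) * g (t q) := rfl

theorem riemannSum_one (t : RegOpen S → S) (P : Finpartition (⊤ : RegOpen S)) (R : RegOpen S) :
    μ.riemannSum t P R 1 = μ.toFun R := by
  simp only [riemannSum_apply, BoundedContinuousFunction.coe_one, Pi.one_apply, mul_one,
    sum_inf_parts]

theorem abs_riemannSum_le (t : RegOpen S → S) (P : Finpartition (⊤ : RegOpen S))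
    (R : RegOpen S) (g : S →ᵇ ℝ) : |μ.riemannSum t P R g| ≤ μ.toFun R * ‖g‖ := by
  rw [riemannSum_apply, ← μ.sum_inf_parts R P, Finset.sum_mul]
  refine (Finset.abs_sum_le_sum_abs _ _).trans (Finset.sum_le_sum fun q _ => ?_)
  rw [abs_mul, abs_of_nonneg (μ.nonneg _)]
  exact mul_le_mul_of_nonneg_left (g.norm_coe_le_norm _) (μ.nonneg _)

theorem isFinitelyAdditive_riemannSum (t : RegOpen S → S) (P : Finpartition (⊤ : RegOpen S)) :
    IsFinitelyAdditive (μ.riemannSum t P) := fun a b h => LinearMap.ext fun g => by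
  simp only [LinearMap.add_apply, riemannSum_apply, ← Finset.sum_add_distrib, ← add_mul]
  refine Finset.sum_congr rfl fun q _ => ?_
  have hq : μ.toFun ((a ⊔ b) ⊓ q) = μ.toFun (a ⊓ q) + μ.toFun (b ⊓ q) :=
    (congrArg μ.toFun (inf_sup_right a b q)).trans
      (μ.isFinitelyAdditive _ _ (h.mono inf_le_left inf_le_left))
  rw [hq]

theorem riemannSum_mono {t : RegOpen S → S} (ht : ∀ q, q ≠ ⊥ → t q ∈ q.set)
    {P : Finpartition (⊤ : RegOpen S)} {R : RegOpen S} (hP : ∀ q ∈ P.parts, q ≤ R ∨ q ≤ Rᶜ) :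
    IsMonotoneOver R.set (μ.riemannSum t P R) := fun f g hfg => by
  refine Finset.sum_le_sum fun q hq => ?_
  rcases hP q hq with h | h
  · exact mul_le_mul_of_nonneg_left
      (hfg _ (RegOpen.set_subset_iff.2 h (ht q (P.ne_bot hq)))) (μ.nonneg _)
  · have hRq : R ⊓ q = ⊥ := (disjoint_compl_right.mono_right h).eq_bot
    simp [hRq, μ.isFinitelyAdditive.map_bot]

theorem exists_isCompatible : ∃ I : Integrator S, I.IsCompatible μ := by
  classical
  have := μ.nonempty
  choose! t ht using fun q : RegOpen S => RegOpen.exists_mem_of_ne_bot (R := q)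
  obtain ⟨U, hU⟩ := Ultrafilter.exists_le (atBot : Filter (Finpartition (⊤ : RegOpen S)))
  choose J hJ using fun R =>
    exists_linearMap_tendsto U (μ.riemannSum t · R) _ (μ.abs_riemannSum_le t · R)
  have hadd : IsFinitelyAdditive J := fun a b h => LinearMap.ext fun g =>
    tendsto_nhds_unique (hJ (a ⊔ b) g) <| ((hJ a g).add (hJ b g)).congr fun P =>
      (DFunLike.congr_fun (μ.isFinitelyAdditive_riemannSum t P a b h) g).symm
  have hmono : ∀ R, IsMonotoneOver R.set (J R) := fun R f g hfg =>
    le_of_tendsto_of_tendsto (hJ R f) (hJ R g) <|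
      Eventually.mono (hU (eventually_forall_parts_le_or_le_compl R)) fun P hP =>
        μ.riemannSum_mono ht hP f g hfg
  refine ⟨Integrator.ofLinearMaps J hadd hmono, Integrator.isCompatible_iff.2 fun R => ?_⟩
  rw [Integrator.int_ofLinearMaps]
  exact tendsto_nhds_unique (hJ R 1) (tendsto_const_nhds.congr fun P =>
    (μ.riemannSum_one t P R).symm)

theorem existsUnique_isCompatible : ∃! I : Integrator S, I.IsCompatible μ :=
  let ⟨I, hI⟩ := μ.exists_isCompatible
  ⟨I, hI, fun _ hI' => hI'.unique hI⟩

end Credence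

theorem IsFinitelyAdditive.comp_orderIso {α β M : Type*} [Lattice α] [OrderBot α] [Lattice β]
    [OrderBot β] [Add M] {Φ : α → M} (h : IsFinitelyAdditive Φ) (e : β ≃o α) :
    IsFinitelyAdditive (Φ ∘ e) := fun a b hab => by
  simp only [Function.comp_apply, e.map_sup, h _ _ (hab.map_orderIso e)]

namespace RegOpen

variable {S X : Type*} [TopologicalSpace S] [TopologicalSpace X] {ι : S → X}
  (hι : IsDenseInducing ι)

include hι in
theorem interior_compl_preimage {U : Set X} (hU : IsOpen U) :
    interior (ι ⁻¹' U)ᶜ = ι ⁻¹' interior Uᶜ := by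
  refine subset_antisymm (fun s hs => ?_) ?_
  · obtain ⟨V, hVs, hV, hsV⟩ := mem_interior.1 hs
    obtain ⟨W, hW, rfl⟩ := hι.isInducing.isOpen_iff.1 hV
    refine mem_interior.2 ⟨W, fun x hxW hxU => ?_, hW, hsV⟩
    obtain ⟨y, hyW, hyU⟩ := hι.dense.exists_mem_open (hW.inter hU) ⟨x, hxW, hxU⟩
    exact hVs hyW hyU
  · exact preimage_interior_subset_interior_preimage hι.continuous

theorem comap_compl (U : Opens X) :
    Opens.comap ⟨ι, hι.continuous⟩ Uᶜ = (Opens.comap ⟨ι, hι.continuous⟩ U)ᶜ := by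
  apply SetLike.coe_injective
  simp only [Opens.coe_comap, Opens.coe_compl_eq_interior_compl]
  exact (interior_compl_preimage hι U.isOpen).symm

/-- The trace `ι ⁻¹' Q` of a regular open set on a dense subspace. -/
def trace (Q : RegOpen X) : RegOpen S :=
  ⟨Opens.comap ⟨ι, hι.continuous⟩ (Q : Opens X), by
    rw [Heyting.IsRegular, ← comap_compl hι, ← comap_compl hι]
    exact congrArg _ Q.2.eq⟩

theorem set_trace (Q : RegOpen X) : (trace hι Q).set = ι ⁻¹' Q.set := rfl

theorem closure_image_trace (Q : RegOpen X) :
    closure (ι '' (trace hι Q).set) = closure Q.set := by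
  rw [set_trace, Set.image_preimage_eq_inter_range]
  exact subset_antisymm (closure_mono Set.inter_subset_left)
    (closure_minimal (hι.dense.open_subset_closure_inter Q.isOpen_set) isClosed_closure)

theorem trace_le_trace_iff {Q R : RegOpen X} : trace hι Q ≤ trace hι R ↔ Q ≤ R := by
  refine ⟨fun h => set_subset_iff.1 ?_, fun h => ?_⟩
  · rw [← interior_closure_set Q, ← interior_closure_set R, ← closure_image_trace hι,
      ← closure_image_trace hι]
    exact interior_mono (closure_mono (Set.image_mono h))
  · exact set_subset_iff.1 (Set.preimage_mono (f := ι) (set_subset_iff.2 h))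

theorem trace_surjective : Function.Surjective (trace hι) := fun R => by
  obtain ⟨W, hW, hWR⟩ := hι.isInducing.isOpen_iff.1 R.isOpen_set
  have hcomap : Opens.comap ⟨ι, hι.continuous⟩ ⟨W, hW⟩ = (R : Opens S) :=
    SetLike.coe_injective hWR
  refine ⟨hull ⟨W, hW⟩, Heyting.Regular.coe_injective ?_⟩
  change Opens.comap ⟨ι, hι.continuous⟩ (⟨W, hW⟩ : Opens X)ᶜᶜ = R
  rw [comap_compl hι, comap_compl hι, hcomap]
  exact R.2.eq

/-- Taking traces identifies the regular open algebras of a space and of a dense subspace. -/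
noncomputable def traceIso : RegOpen X ≃o RegOpen S :=
  RelIso.ofSurjective (OrderEmbedding.ofMapLEIff (trace hι) fun _ _ => trace_le_trace_iff hι)
    (trace_surjective hι)

theorem isRegExtension_iff {R : RegOpen S} {Q : RegOpen X} :
    IsRegExtension ι R Q ↔ traceIso hι Q = R :=
  ⟨fun h => ext_set h, fun h => h ▸ rfl⟩

include hι in
theorem existsUnique_isRegExtension (R : RegOpen S) : ∃! Q : RegOpen X, IsRegExtension ι R Q := by
  simpa only [isRegExtension_iff hι] using (traceIso hι).bijective.existsUnique R

end RegOpen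

/-- The credence on a compactification corresponding to a credence on a dense subspace. -/
noncomputable def Credence.extend {S X : Type*} [TopologicalSpace S] [TopologicalSpace X]
    {ι : S → X} (hι : IsDenseInducing ι) (μ : Credence S) : Credence X where
  toFun Q := μ.toFun (RegOpen.traceIso hι Q)
  mem_Icc Q := μ.mem_Icc _
  top_eq := (congrArg μ.toFun (map_top (RegOpen.traceIso hι))).trans μ.top_eq
  additive N B hB := by
    have hsup := map_finset_sup (RegOpen.traceIso hι) Finset.univ B
    exact (congrArg μ.toFun hsup).trans
      (μ.additive N _ fun i j hij => (hB hij).map_orderIso (RegOpen.traceIso hι))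

namespace Integrator

variable {S X : Type*} [TopologicalSpace S] [TopologicalSpace X] {ι : S → X}
  (hι : IsDenseInducing ι)

/-- The integrator on a compactification corresponding to an integrator on a dense subspace: it
integrates the pullback of functions along the inclusion. -/
noncomputable def extend (I : Integrator S) : Integrator X :=
  ofLinearMaps
    (fun Q => I.intLM (RegOpen.traceIso hι Q) ∘ₗ
      BoundedContinuousFunction.compContinuousCLM ℝ ℝ ⟨ι, hι.continuous⟩)
    (fun a b h => (congrArg (LinearMap.comp · _)
      (I.isFinitelyAdditive_intLM.comp_orderIso (RegOpen.traceIso hι) a b h)).trans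
        (LinearMap.add_comp _ _ _))
    fun _ _ _ h => I.isMonotoneOver_intLM _ _ _ fun s hs => h (ι s) hs

theorem int_extend (I : Integrator S) (Q : RegOpen X) (f : X →ᵇ ℝ) :
    (I.extend hι).int Q f =
      I.int (RegOpen.traceIso hι Q) (f.compContinuous ⟨ι, hι.continuous⟩) :=
  int_ofLinearMaps _ _ Q f

theorem IsCompatible.extend {I : Integrator S} {μ : Credence S} (h : I.IsCompatible μ) :
    (I.extend hι).IsCompatible (μ.extend hι) :=
  isCompatible_iff.2 fun Q => (int_extend hι I Q 1).trans (isCompatible_iff.1 h _)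

end Integrator

namespace LiminalDensity

variable {X : Type*} [TopologicalSpace X] [MeasurableSpace X] {ν : Measure X}
  (φ : LiminalDensity ν)

/-- The indicator of `R` completed by the density on the boundary of `R`: integrating against it
gives the integral over `R` determined by `ν` and `φ`. -/
noncomputable def weight (R : RegOpen X) (x : X) : ℝ :=
  R.set.indicator 1 x + (frontier R.set).indicator (φ.density R) x

theorem weight_of_mem {R : RegOpen X} {x : X} (hx : x ∈ R.set) : φ.weight R x = 1 := by
  have hx' : x ∉ frontier R.set := fun h => RegOpen.notMem_of_mem_frontier h hx
  simp [weight, hx, hx']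

theorem weight_of_mem_frontier {R : RegOpen X} {x : X} (hx : x ∈ frontier R.set) :
    φ.weight R x = φ.density R x := by
  simp [weight, hx, RegOpen.notMem_of_mem_frontier hx]

theorem weight_of_notMem_closure {R : RegOpen X} {x : X} (hx : x ∉ closure R.set) :
    φ.weight R x = 0 := by
  have hfrontier : x ∉ frontier R.set := fun h => hx h.1
  have hR : x ∉ R.set := fun h => hx (subset_closure h)
  simp [weight, hfrontier, hR]

variable [OpensMeasurableSpace X]

theorem weight_mem_Icc (R : RegOpen X) : ∀ᵐ x ∂ν, φ.weight R x ∈ Set.Icc (0 : ℝ) 1 := by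
  filter_upwards [(ae_restrict_iff' isClosed_frontier.measurableSet).1 (φ.mem_Icc R)] with x hx
  by_cases hfrontier : x ∈ frontier R.set
  · rw [φ.weight_of_mem_frontier hfrontier]
    exact hx hfrontier
  by_cases hcl : x ∈ closure R.set
  · simp [φ.weight_of_mem (RegOpen.mem_of_mem_closure_of_notMem_frontier hcl hfrontier)]
  · simp [φ.weight_of_notMem_closure hcl]

theorem sum_weight {N : ℕ} {B : Fin N → RegOpen X} (hB : IsRegPartition ⊤ B) :
    ∀ᵐ x ∂ν, ∑ n, φ.weight (B n) x = 1 := by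
  filter_upwards [(ae_restrict_iff' (MeasurableSet.iUnion fun n =>
    isClosed_frontier.measurableSet)).1 (φ.partition N B hB)] with x hx
  by_cases hfrontier : x ∈ ⋃ n, frontier (B n).set
  · rw [← hx hfrontier]
    obtain ⟨n, hn⟩ := Set.mem_iUnion.1 hfrontier
    refine Finset.sum_congr rfl fun i _ => ?_
    simp [weight, hB.notMem_of_mem_frontier hn i]
  · simp only [Set.mem_iUnion, not_exists] at hfrontier
    obtain ⟨n, hn⟩ := hB.exists_mem_of_forall_notMem_frontier hfrontier
    rw [Finset.sum_eq_single_of_mem n (Finset.mem_univ n), φ.weight_of_mem hn]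
    exact fun i _ hi => φ.weight_of_notMem_closure
      (Set.disjoint_left.1 (RegOpen.disjoint_closure (hB.1 hi.symm)) hn)

theorem weight_sup {a b : RegOpen X} (h : Disjoint a b) :
    ∀ᵐ x ∂ν, φ.weight (a ⊔ b) x = φ.weight a x + φ.weight b x := by
  filter_upwards [φ.sum_weight (RegOpen.isRegPartition_top_triple h),
    φ.sum_weight (RegOpen.isRegPartition_top_pair (a ⊔ b))] with x htriple hpair
  simp only [Fin.sum_univ_succ, Fin.sum_univ_zero, Matrix.cons_val_zero, Matrix.cons_val_succ]
    at htriple hpair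
  linarith

/-- The liminal density structure given by a family of functions that have the properties of
weights. -/
noncomputable def ofWeights (d : RegOpen X → X → ℝ) (hint : ∀ R, Integrable (d R) ν)
    (hIcc : ∀ R, ∀ᵐ x ∂ν, d R x ∈ Set.Icc (0 : ℝ) 1)
    (hsupp : ∀ R : RegOpen X, ∀ᵐ x ∂ν, x ∉ closure R.set → d R x = 0)
    (hsum : ∀ (N : ℕ) (B : Fin N → RegOpen X), IsRegPartition ⊤ B → ∀ᵐ x ∂ν, ∑ n, d (B n) x = 1) :
    LiminalDensity ν where
  density := d
  integrable R := (hint R).integrableOn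
  mem_Icc R := ae_restrict_of_ae (hIcc R)
  partition N B hB := by
    rw [ae_restrict_iff' (MeasurableSet.iUnion fun n => isClosed_frontier.measurableSet)]
    filter_upwards [hsum N B hB, eventually_all.2 fun n => hsupp (B n)] with x hx hx0 hfrontier
    obtain ⟨n, hn⟩ := Set.mem_iUnion.1 hfrontier
    rw [← hx]
    refine Finset.sum_congr rfl fun i _ => Set.indicator_apply_eq_self.2 fun hi => ?_
    refine hx0 i fun hcl => ?_
    exact hB.notMem_of_mem_frontier hn i (RegOpen.mem_of_mem_closure_of_notMem_frontier hcl hi)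

theorem weight_ofWeights {d : RegOpen X → X → ℝ} (hint : ∀ R, Integrable (d R) ν)
    (hIcc : ∀ R, ∀ᵐ x ∂ν, d R x ∈ Set.Icc (0 : ℝ) 1)
    (hsupp : ∀ R : RegOpen X, ∀ᵐ x ∂ν, x ∉ closure R.set → d R x = 0)
    (hsum : ∀ (N : ℕ) (B : Fin N → RegOpen X), IsRegPartition ⊤ B → ∀ᵐ x ∂ν, ∑ n, d (B n) x = 1)
    (R : RegOpen X) : (ofWeights d hint hIcc hsupp hsum).weight R =ᵐ[ν] d R := by
  filter_upwards [hsum 2 _ (RegOpen.isRegPartition_top_pair R), hsupp R, hsupp Rᶜ]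
    with x hsum_x hR hRc
  by_cases hfrontier : x ∈ frontier R.set
  · exact weight_of_mem_frontier _ hfrontier
  by_cases hcl : x ∈ closure R.set
  · have hxR := RegOpen.mem_of_mem_closure_of_notMem_frontier hcl hfrontier
    have hdc : d Rᶜ x = 0 := hRc (by simpa [RegOpen.closure_set_compl] using hxR)
    have hd : d R x = 1 := by simpa [Fin.sum_univ_two, hdc] using hsum_x
    rw [weight_of_mem _ hxR, hd]
  · rw [weight_of_notMem_closure _ hcl, hR hcl]

variable [IsFiniteMeasure ν]

theorem integrable_weight (R : RegOpen X) : Integrable (φ.weight R) ν :=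
  ((integrable_const (1 : ℝ)).indicator R.isOpen_set.measurableSet).add
    ((integrable_indicator_iff isClosed_frontier.measurableSet).2 (φ.integrable R))

theorem integrable_mul_weight (f : X →ᵇ ℝ) (R : RegOpen X) :
    Integrable (fun x => f x * φ.weight R x) ν :=
  (φ.integrable_weight R).bdd_mul f.continuous.aestronglyMeasurable
    (Eventually.of_forall f.norm_coe_le_norm)

theorem integral_mul_weight (f : X →ᵇ ℝ) (R : RegOpen X) :
    ∫ x, f x * φ.weight R x ∂ν =
      (∫ x in R.set, f x ∂ν) + ∫ x in frontier R.set, f x * φ.density R x ∂ν := by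
  have hφ : IntegrableOn (fun x => f x * φ.density R x) (frontier R.set) ν :=
    (φ.integrable R).bdd_mul f.continuous.aestronglyMeasurable
      (Eventually.of_forall f.norm_coe_le_norm)
  rw [← integral_indicator R.isOpen_set.measurableSet,
    ← integral_indicator isClosed_frontier.measurableSet,
    ← integral_add ((f.integrable ν).indicator R.isOpen_set.measurableSet)
      ((integrable_indicator_iff isClosed_frontier.measurableSet).2 hφ)]
  congr 1 with x
  by_cases hR : x ∈ R.set <;> by_cases hfrontier : x ∈ frontier R.set <;>
    simp [weight, hR, hfrontier, mul_add]

/-- Integration against the weight of `R`, as a linear functional. -/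
noncomputable def weightedIntegral (R : RegOpen X) : (X →ᵇ ℝ) →ₗ[ℝ] ℝ where
  toFun f := ∫ x, f x * φ.weight R x ∂ν
  map_add' f g := by
    simp only [BoundedContinuousFunction.coe_add, Pi.add_apply, add_mul]
    exact integral_add (φ.integrable_mul_weight f R) (φ.integrable_mul_weight g R)
  map_smul' c f := by
    simp [mul_assoc, integral_const_mul]

theorem weightedIntegral_apply (R : RegOpen X) (f : X →ᵇ ℝ) :
    φ.weightedIntegral R f = ∫ x, f x * φ.weight R x ∂ν := rfl

theorem isFinitelyAdditive_weightedIntegral : IsFinitelyAdditive φ.weightedIntegral :=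
  fun a b h => LinearMap.ext fun f => by
    rw [LinearMap.add_apply, weightedIntegral_apply, weightedIntegral_apply,
      weightedIntegral_apply,
      ← integral_add (φ.integrable_mul_weight f a) (φ.integrable_mul_weight f b)]
    refine integral_congr_ae ?_
    filter_upwards [φ.weight_sup h] with x hx
    rw [hx, mul_add]

theorem isMonotoneOver_weightedIntegral (R : RegOpen X) :
    IsMonotoneOver R.set (φ.weightedIntegral R) := fun f g hfg => by
  have hcl : ∀ x ∈ closure R.set, f x ≤ g x := fun x hx =>
    closure_minimal (t := {x | f x ≤ g x}) hfg (isClosed_le f.continuous g.continuous) hx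
  refine integral_mono_ae (φ.integrable_mul_weight f R) (φ.integrable_mul_weight g R) ?_
  filter_upwards [φ.weight_mem_Icc R] with x hx
  by_cases hxR : x ∈ closure R.set
  · exact mul_le_mul_of_nonneg_right (hcl x hxR) hx.1
  · simp [φ.weight_of_notMem_closure hxR]

/-- The integrator represented by a finite measure and a liminal density structure. -/
noncomputable def integrator : Integrator X :=
  .ofLinearMaps φ.weightedIntegral φ.isFinitelyAdditive_weightedIntegral
    φ.isMonotoneOver_weightedIntegral

theorem int_integrator (R : RegOpen X) (f : X →ᵇ ℝ) :
    φ.integrator.int R f = ∫ x, f x * φ.weight R x ∂ν :=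
  Integrator.int_ofLinearMaps _ _ R f

theorem int_integrator_top (f : X →ᵇ ℝ) : φ.integrator.int ⊤ f = ∫ x, f x ∂ν := by
  simp [int_integrator, φ.weight_of_mem (R := ⊤) (Set.mem_univ _)]

theorem represents_iff {S : Type*} [TopologicalSpace S] {ι : S → X} (hι : IsDenseInducing ι)
    {μ : Credence S} : Represents ι ν φ μ ↔ φ.integrator.IsCompatible (μ.extend hι) := by
  have hint : ∀ Q : RegOpen X, φ.integrator.int Q 1 =
      ν.real Q.set + ∫ x in frontier Q.set, φ.density Q x ∂ν := fun Q => by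
    rw [int_integrator, integral_mul_weight]
    simp
  simp only [Integrator.isCompatible_iff, hint, Represents, RegOpen.isRegExtension_iff hι]
  exact ⟨fun h Q => (h _ Q rfl).symm, fun h R Q hQ => hQ ▸ (h Q).symm⟩

end LiminalDensity

theorem Represents.isProbabilityMeasure {S X : Type*} [TopologicalSpace S] [TopologicalSpace X]
    [MeasurableSpace X] {ι : S → X} {ν : Measure X} {φ : LiminalDensity ν} {μ : Credence S}
    (h : Represents ι ν φ μ) : IsProbabilityMeasure ν := by
  have htop : μ.toFun ⊤ = ν.real Set.univ := by
    simpa [RegOpen.set_top] using h ⊤ ⊤ rfl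
  rw [μ.top_eq, Measure.real, eq_comm, ENNReal.toReal_eq_one_iff] at htop
  exact ⟨htop⟩

theorem IsNormalMeasure.regular {X : Type*} [TopologicalSpace X] [CompactSpace X]
    [MeasurableSpace X] [OpensMeasurableSpace X] {ν : Measure X} [IsFiniteMeasure ν]
    (h : IsNormalMeasure ν) : ν.Regular where
  toOuterRegular := h.2
  innerRegular _U hU r hr :=
    let ⟨K, hKU, hK, hrK⟩ := h.1 hU.measurableSet r hr
    ⟨K, hKU, hK.isCompact, hrK⟩

theorem isNormalMeasure_of_weaklyRegular {X : Type*} [TopologicalSpace X] [MeasurableSpace X]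
    (ν : Measure X) [IsFiniteMeasure ν] [ν.WeaklyRegular] : IsNormalMeasure ν :=
  ⟨fun _ hA => Measure.WeaklyRegular.innerRegular_measurable ⟨hA, measure_ne_top ν _⟩,
    inferInstance⟩

theorem ae_eq_zero_of_forall_integral_boundedContinuous_mul_eq_zero {X : Type*}
    [TopologicalSpace X] [NormalSpace X] [MeasurableSpace X] [BorelSpace X] {ν : Measure X}
    [IsFiniteMeasure ν] [ν.WeaklyRegular] {h : X → ℝ} (hh : MemLp h 2 ν)
    (hzero : ∀ f : X →ᵇ ℝ, ∫ x, f x * h x ∂ν = 0) : h =ᵐ[ν] 0 := by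
  have hLp : hh.toLp h = 0 := by
    refine (BoundedContinuousFunction.toLp_denseRange ℝ ν ℝ
      (ENNReal.ofNat_ne_top (n := 2))).eq_zero_of_inner_right ℝ ?_
    intro f
    rw [L2.inner_def, ← hzero f]
    refine integral_congr_ae ?_
    filter_upwards [hh.coeFn_toLp, BoundedContinuousFunction.coeFn_toLp 2 ν ℝ f] with x hx hfx
    simp [hx, hfx, mul_comm]
  exact (hh.toLp_eq_toLp_iff MemLp.zero).1 (hLp.trans (MemLp.toLp_zero _).symm)

theorem measure_compl_closure_eq_zero {X : Type*} [TopologicalSpace X] [LocallyCompactSpace X]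
    [T2Space X] [MeasurableSpace X] [BorelSpace X] {m : Measure X} [IsFiniteMeasure m] [m.Regular]
    {U : Set X} (h : ∀ f : X →ᵇ ℝ, (∀ x ∈ U, f x = 0) → ∫ x, f x ∂m = 0) :
    m (closure U)ᶜ = 0 := by
  have hopen : IsOpen (closure U)ᶜ := isClosed_closure.isOpen_compl
  simp only [hopen.measure_eq_iSup_isCompact m, ENNReal.iSup_eq_zero]
  intro K hKU hK
  obtain ⟨f, hfK, -, hfU, hfIcc⟩ :=
    exists_continuousMap_one_of_isCompact_subset_isOpen hK hopen hKU
  let F : X →ᵇ ℝ := .ofNormedAddCommGroup f f.continuous 1 fun x => by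
    simpa [abs_of_nonneg (hfIcc x).1] using (hfIcc x).2
  have hF : ∫ x, F x ∂m = 0 := h F fun x hx => by
    by_contra hfx
    exact hfU (subset_tsupport f hfx) (subset_closure hx)
  have hF0 : F =ᵐ[m] 0 :=
    (integral_eq_zero_iff_of_nonneg (fun x => (hfIcc x).1) (F.integrable m)).1 hF
  refine measure_mono_null (fun x hx => ?_) hF0
  have hfx : F x = 1 := hfK hx
  simp [hfx]

theorem rnDeriv_finset_sum {α κ : Type*} [MeasurableSpace α] (s : Finset κ) (m : κ → Measure α)
    [∀ i, IsFiniteMeasure (m i)] (ν : Measure α) [SigmaFinite ν] :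
    (∑ i ∈ s, m i).rnDeriv ν =ᵐ[ν] fun x => ∑ i ∈ s, (m i).rnDeriv ν x := by
  classical
  induction s using Finset.induction_on with
  | empty => exact Measure.rnDeriv_zero ν
  | insert i s hi ih =>
    rw [Finset.sum_insert hi]
    filter_upwards [Measure.rnDeriv_add (m i) (∑ i ∈ s, m i) ν, ih] with x hadd hx
    rw [hadd, Finset.sum_insert hi, Pi.add_apply, hx]

section Representation

variable {X : Type*} [TopologicalSpace X] [CompactSpace X] [T2Space X] [MeasurableSpace X]
  [BorelSpace X]

namespace Integrator

variable (I : Integrator X)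

/-- The regular measure on the compact space `X` that represents the integral over `R`, as a
functional of continuous functions on all of `X`. -/
noncomputable def rieszMeasure (R : RegOpen X) : Measure X :=
  RealRMK.rieszMeasure <| PositiveLinearMap.mk₀
    { toFun f := I.int R (.mkOfCompact f)
      map_add' f g := map_add (I.intLM R) (.mkOfCompact f) (.mkOfCompact g)
      map_smul' c f := map_smul (I.intLM R) c (.mkOfCompact f) }
    fun _ hf => (I.isMonotoneOver_intLM R).nonneg fun x _ => hf x

instance (R : RegOpen X) : (I.rieszMeasure R).Regular :=
  inferInstanceAs (RealRMK.rieszMeasure _).Regular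

theorem integral_rieszMeasure (R : RegOpen X) (f : X →ᵇ ℝ) :
    ∫ x, f x ∂I.rieszMeasure R = I.int R f :=
  RealRMK.integral_rieszMeasure _
    (CompactlySupportedContinuousMap.continuousMapEquiv f.toContinuousMap)

theorem rieszMeasure_eq_sum {R : RegOpen X} {N : ℕ} {B : Fin N → RegOpen X}
    (hB : IsRegPartition R B) : I.rieszMeasure R = ∑ n, I.rieszMeasure (B n) :=
  Measure.ext_of_integral_eq_on_compactlySupported fun f => by
    let F : X →ᵇ ℝ := .mkOfCompact f
    change ∫ x, F x ∂_ = ∫ x, F x ∂_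
    rw [integral_finsetSum_measure fun n _ => F.integrable _]
    simp only [integral_rieszMeasure]
    exact I.partition R N B hB F

theorem rieszMeasure_le_top (R : RegOpen X) : I.rieszMeasure R ≤ I.rieszMeasure ⊤ := by
  rw [I.rieszMeasure_eq_sum (RegOpen.isRegPartition_top_pair R), Fin.sum_univ_two]
  exact Measure.le_add_right le_rfl

theorem rieszMeasure_absolutelyContinuous (R : RegOpen X) : I.rieszMeasure R ≪ I.rieszMeasure ⊤ :=
  Measure.absolutelyContinuous_of_le (I.rieszMeasure_le_top R)

theorem rieszMeasure_compl_closure (R : RegOpen X) : I.rieszMeasure R (closure R.set)ᶜ = 0 :=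
  measure_compl_closure_eq_zero fun f hf =>
    (I.integral_rieszMeasure R f).trans ((I.isMonotoneOver_intLM R).eq_zero hf)

/-- The share of the integral over `R` in the integral over the whole space. -/
noncomputable def density (R : RegOpen X) (x : X) : ℝ :=
  ((I.rieszMeasure R).rnDeriv (I.rieszMeasure ⊤) x).toReal

theorem integrable_density (R : RegOpen X) : Integrable (I.density R) (I.rieszMeasure ⊤) :=
  Measure.integrable_toReal_rnDeriv

theorem density_mem_Icc (R : RegOpen X) :
    ∀ᵐ x ∂I.rieszMeasure ⊤, I.density R x ∈ Set.Icc (0 : ℝ) 1 := by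
  filter_upwards [Measure.rnDeriv_le_one_of_le (I.rieszMeasure_le_top R)] with x hx
  exact ⟨ENNReal.toReal_nonneg, ENNReal.toReal_le_of_le_ofReal zero_le_one (by simpa using hx)⟩

theorem density_eq_zero_of_notMem_closure (R : RegOpen X) :
    ∀ᵐ x ∂I.rieszMeasure ⊤, x ∉ closure R.set → I.density R x = 0 := by
  have hzero := I.rieszMeasure_compl_closure R
  rw [← Measure.setLIntegral_rnDeriv (I.rieszMeasure_absolutelyContinuous R),
    setLIntegral_eq_zero_iff isClosed_closure.measurableSet.compl
      (Measure.measurable_rnDeriv _ _)] at hzero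
  filter_upwards [hzero] with x hx hxR
  simp [density, hx hxR]

theorem sum_density {N : ℕ} {B : Fin N → RegOpen X} (hB : IsRegPartition ⊤ B) :
    ∀ᵐ x ∂I.rieszMeasure ⊤, ∑ n, I.density (B n) x = 1 := by
  have hsum := rnDeriv_finset_sum Finset.univ (fun n => I.rieszMeasure (B n)) (I.rieszMeasure ⊤)
  rw [← I.rieszMeasure_eq_sum hB] at hsum
  filter_upwards [hsum, Measure.rnDeriv_self (I.rieszMeasure ⊤),
    eventually_all.2 fun n => Measure.rnDeriv_lt_top (I.rieszMeasure (B n)) (I.rieszMeasure ⊤)]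
    with x hx hself hfin
  simp only [density]
  rw [← ENNReal.toReal_sum fun n _ => (hfin n).ne, ← hx, hself, ENNReal.toReal_one]

/-- The liminal density structure of an integrator, subordinate to the measure that represents
the integral over the whole space. -/
noncomputable def liminalDensity : LiminalDensity (I.rieszMeasure ⊤) :=
  .ofWeights I.density I.integrable_density I.density_mem_Icc I.density_eq_zero_of_notMem_closure
    fun _ _ hB => I.sum_density hB

theorem integrator_liminalDensity : I.liminalDensity.integrator = I :=
  ext_int fun R f => calc
    I.liminalDensity.integrator.int R f
      = ∫ x, f x * I.liminalDensity.weight R x ∂I.rieszMeasure ⊤ :=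
        I.liminalDensity.int_integrator R f
    _ = ∫ x, I.density R x • f x ∂I.rieszMeasure ⊤ := by
        refine integral_congr_ae ?_
        filter_upwards [LiminalDensity.weight_ofWeights I.integrable_density I.density_mem_Icc
          I.density_eq_zero_of_notMem_closure (fun _ _ hB => I.sum_density hB) R] with x hx
        rw [liminalDensity, hx, smul_eq_mul, mul_comm]
    _ = ∫ x, f x ∂I.rieszMeasure R :=
        integral_rnDeriv_smul (I.rieszMeasure_absolutelyContinuous R)
    _ = I.int R f := I.integral_rieszMeasure R f

theorem exists_integrator_eq : ∃ (ν : Measure X) (φ : LiminalDensity ν) (_ : IsFiniteMeasure ν),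
    ν.Regular ∧ φ.integrator = I :=
  ⟨_, I.liminalDensity, inferInstance, inferInstance, I.integrator_liminalDensity⟩

end Integrator

theorem LiminalDensity.unique {ν ν' : Measure X} [IsFiniteMeasure ν] [IsFiniteMeasure ν']
    [ν.Regular] [ν'.Regular] {φ : LiminalDensity ν} {φ' : LiminalDensity ν'}
    (h : φ'.integrator = φ.integrator) :
    ν' = ν ∧ ∀ R : RegOpen X, φ'.density R =ᵐ[ν.restrict (frontier R.set)] φ.density R := by
  have hint : ∀ (f : X →ᵇ ℝ) R, ∫ x, f x * φ'.weight R x ∂ν' = ∫ x, f x * φ.weight R x ∂ν :=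
    fun f R => by rw [← int_integrator, h, int_integrator]
  obtain rfl : ν' = ν := Measure.ext_of_integral_eq_on_compactlySupported fun f => by
    have htop := φ.int_integrator_top (.mkOfCompact f)
    rw [← h, int_integrator_top] at htop
    exact htop
  refine ⟨rfl, fun R => ?_⟩
  have hmem : MemLp (φ'.weight R - φ.weight R) 2 ν' := by
    refine .of_bound ((φ'.integrable_weight R).sub (φ.integrable_weight R)).1 1 ?_
    filter_upwards [φ'.weight_mem_Icc R, φ.weight_mem_Icc R] with x hx' hx
    exact (abs_sub_le_of_le_of_le hx'.1 hx'.2 hx.1 hx.2).trans_eq (sub_zero 1)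
  have hweight := ae_eq_zero_of_forall_integral_boundedContinuous_mul_eq_zero hmem fun f => by
    simp only [Pi.sub_apply, mul_sub]
    rw [integral_sub (φ'.integrable_mul_weight f R) (φ.integrable_mul_weight f R), hint,
      sub_self]
  rw [Filter.EventuallyEq, ae_restrict_iff' isClosed_frontier.measurableSet]
  filter_upwards [hweight] with x hx hxR
  rw [← φ'.weight_of_mem_frontier hxR, ← φ.weight_of_mem_frontier hxR]
  exact sub_eq_zero.1 hx

end Representation

theorem mainTheorem4_general {S Sbar : Type*} [TopologicalSpace S] [TopologicalSpace Sbar]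
    [CompactSpace Sbar] [T2Space Sbar] [MeasurableSpace Sbar] [BorelSpace Sbar]
    (ι : S → Sbar) (hι : IsDenseInducing ι) (μ : Credence S) :
    (∃! I : Integrator S, I.IsCompatible μ) ∧
    (∀ R : RegOpen S, ∃! Rbar : RegOpen Sbar, IsRegExtension ι R Rbar) ∧
    ∃ (ν : Measure Sbar) (φ : LiminalDensity ν),
      IsProbabilityMeasure ν ∧ IsNormalMeasure ν ∧
      Represents ι ν φ μ ∧
      (∀ (ν' : Measure Sbar) (φ' : LiminalDensity ν'),
        IsNormalMeasure ν' → Represents ι ν' φ' μ →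
          ν' = ν ∧
          ∀ Rbar : RegOpen Sbar,
            φ'.density Rbar =ᵐ[ν.restrict (frontier Rbar.set)] φ.density Rbar) ∧
      (∀ I : Integrator S, I.IsCompatible μ →
        ∀ (R : RegOpen S) (Rbar : RegOpen Sbar), IsRegExtension ι R Rbar →
          ∀ (f : S →ᵇ ℝ) (fbar : C(Sbar, ℝ)), (∀ s, fbar (ι s) = f s) →
            I.int R f = (∫ x in Rbar.set, fbar x ∂ν) +
              ∫ x in frontier Rbar.set, fbar x * φ.density Rbar x ∂ν) := by
  obtain ⟨I, hI, hIuniq⟩ := μ.existsUnique_isCompatible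
  obtain ⟨ν, φ, _, _, hφ⟩ := (I.extend hι).exists_integrator_eq
  have hrep : Represents ι ν φ μ := (φ.represents_iff hι).2 (hφ ▸ hI.extend hι)
  refine ⟨⟨I, hI, hIuniq⟩, RegOpen.existsUnique_isRegExtension hι, ν, φ,
    hrep.isProbabilityMeasure, isNormalMeasure_of_weaklyRegular ν, hrep, ?_, ?_⟩
  · intro ν' φ' hν' hrep'
    have := hrep'.isProbabilityMeasure
    have := hν'.regular
    exact LiminalDensity.unique
      (((φ'.represents_iff hι).1 hrep').unique ((φ.represents_iff hι).1 hrep))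
  · intro I' hI' R Rbar hR f fbar hf
    obtain rfl := hIuniq I' hI'
    obtain rfl := (RegOpen.isRegExtension_iff hι).1 hR
    obtain rfl : (BoundedContinuousFunction.mkOfCompact fbar).compContinuous
        ⟨ι, hι.continuous⟩ = f :=
      BoundedContinuousFunction.ext hf
    have hint := φ.int_integrator Rbar (.mkOfCompact fbar)
    rw [hφ, Integrator.int_extend, φ.integral_mul_weight] at hint
    exact hint

theorem mainTheorem4 {S Sbar : Type*} [TopologicalSpace S] [T2Space S] [LocallyCompactSpace S]
    [TopologicalSpace Sbar] [CompactSpace Sbar] [T2Space Sbar]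
    [MeasurableSpace Sbar] [BorelSpace Sbar]
    (ι : S → Sbar) (hι : IsDenseEmbedding ι) (μ : Credence S) :
    -- "the" compatible integrator and "the" extension of a regular open set are well defined
    (∃! I : Integrator S, I.IsCompatible μ) ∧
    (∀ R : RegOpen S, ∃! Rbar : RegOpen Sbar, IsRegExtension ι R Rbar) ∧
    ∃ (ν : Measure Sbar) (φ : LiminalDensity ν),
      IsProbabilityMeasure ν ∧ IsNormalMeasure ν ∧
      -- representation of the credence
      Represents ι ν φ μ ∧
      -- uniqueness of the measure and (almost everywhere) of the liminal density structure
      (∀ (ν' : Measure Sbar) (φ' : LiminalDensity ν'),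
        IsNormalMeasure ν' → Represents ι ν' φ' μ →
          ν' = ν ∧
          ∀ Rbar : RegOpen Sbar,
            φ'.density Rbar =ᵐ[ν.restrict (frontier Rbar.set)] φ.density Rbar) ∧
      -- representation of the integrator on functions extending continuously to `Sbar`
      (∀ I : Integrator S, I.IsCompatible μ →
        ∀ (R : RegOpen S) (Rbar : RegOpen Sbar), IsRegExtension ι R Rbar →
          ∀ (f : S →ᵇ ℝ) (fbar : C(Sbar, ℝ)), (∀ s, fbar (ι s) = f s) →
            I.int R f = (∫ x in Rbar.set, fbar x ∂ν) +
              ∫ x in frontier Rbar.set, fbar x * φ.density Rbar x ∂ν) :=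
  mainTheorem4_general ι hι.toIsDenseInducing μ
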